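/- Let $p$ be a prime, let $P$ be a finite $p$-group, and write maps on the right, with $x^g=g^{-1}xg$. A \emph{prefusion system} on $P$ consists of a set $\mathrm{Hom}_{\mathcal F}(Q,R)$ of injective homomorphisms $Q\to R$ for each pair of subgroups $Q,R\le P$. It is a \emph{fusion system} if it is closed under composition, contains every conjugation map $\theta_g:Q\to R$ ($g\in P$, $Q^g\le R$), contains the isomorphism $Q\to Q\phi$ for each $\phi\in\mathrm{Hom}_{\mathcal F}(Q,R)$, and contains the inverse of each isomorphism that it contains. A subgroup $Q\le P$ is \emph{fully normalized} if $|N_P(Q)|\ge |N_P(R)|$ whenever there is an isomorphism $Q\to R$ in $\mathcal F$. The fusion system $\mathcal F$ is \emph{saturated} if $\mathrm{Aut}_P(P)$ is a Sylow $p$-subgroup of $\mathrm{Aut}_{\mathcal F}(P)$ and every morphism $\phi:Q\to P$ in $\mathcal F$ with $Q\phi$ fully normalized extends to a morphism $N_\phi\to P$ in $\mathcal F$, where $N_\phi$ is the set of $x\in N_P(Q)$ for which there is $y\in N_P(Q\phi)$ with $(g^x)\phi=(g\phi)^y$ for all $g\in Q$. A subgroup $Q$ is \emph{strongly $\mathcal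 F$-closed} if the image of every morphism of $\mathcal F$ whose domain is contained in $Q$ is contained in $Q$; such a $Q$ is normal in $P$. For $Q$ strongly $\mathcal F$-closed, every morphism $\phi:R'\to S'$ in $\mathcal F$ induces a homomorphism $\bar\phi:R'Q/Q\to S'Q/Q$, $Qr\mapsto Q(r\phi)$. Let $\bar{\mathcal F}_Q$ be the prefusion system on $P/Q$ whose morphisms $R/Q\to S/Q$ are the maps $\bar\phi$, where $\phi$ runs over $\mathrm{Hom}_{\mathcal F}(R',S')$ and $R',S'$ run over all subgroups of $P$ with $R'Q=R$ and $S'Q=S$. Let the \emph{factor system} $\mathcal F/Q$ be the fusion system on $P/Q$ whose morphisms $R/Q\to S/Q$, for $Q\le R,S\le P$, are the maps induced by those $\phi\in\mathrm{Hom}_{\mathcal F}(R,S)$ with $Q\phi=Q$. A \emph{morphism} $\mathcal F\to\mathcal E$ of fusion systems on $P$ and $P'$ is a group homomorphism $\Phi:P\to P'$ together with maps $\mathrm{Hom}_{\mathcal F}(R,S)\to\mathrm{Hom}_{\mathcal E}(R\Phi,S\Phi)$, for all $R,S\le P$, that form a functor. \textbf{Theorem.} Let $\mathcal F$ be a saturated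 fusion system on a finite $p$-group $P$, and let $Q$ be a strongly $\mathcal F$-closed subgroup of $P$. Then $\mathcal F/Q=\bar{\mathcal F}_Q$. Consequently the natural map $\mathcal F\to\mathcal F/Q$, given by the quotient homomorphism $P\to P/Q$ and by $\phi\mapsto\bar\phi$ on morphisms, is a morphism of fusion systems. -/

import Mathlib

/-- A prefusion system on a group `P`: for each pair of subgroups `Q`, `R` of `P`, a set of
injective homomorphisms `Q → R`. -/
@[ext]
structure PrefusionSystem (P : Type*) [Group P] where
  Hom : ∀ Q R : Subgroup P, Set (Q →* R)
  injective : ∀ {Q R : Subgroup P} (φ : Q →* R), φ ∈ Hom Q R → Function.Injective φ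

/-- The image `Qφ` of `φ : Q → R`, as a subgroup of `P`. -/
def imageSubgroup {P : Type*} [Group P] {Q R : Subgroup P} (φ : Q →* R) : Subgroup P :=
  φ.range.map R.subtype

/-- The homomorphism `Q → Qφ` obtained from `φ : Q → R` by restricting the codomain. -/
def toImage {P : Type*} [Group P] {Q R : Subgroup P} (φ : Q →* R) : Q →* imageSubgroup φ :=
  (R.subtype.comp φ).codRestrict (imageSubgroup φ) fun x => ⟨φ x, ⟨x, rfl⟩, rfl⟩

/-- For `g ∈ P` with `Q ^ g ≤ R`, the conjugation map `θ_g : Q → R`, `x ↦ x ^ g = g⁻¹ x g`. -/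
def conjHom {P : Type*} [Group P] (Q R : Subgroup P) (g : P)
    (h : ∀ x ∈ Q, g⁻¹ * x * g ∈ R) : Q →* R where
  toFun x := ⟨g⁻¹ * x * g, h x x.2⟩
  map_one' := by ext; simp
  map_mul' x y := by ext; simp [mul_assoc]

/-- A fusion system on `P`. -/
@[ext]
structure FusionSystem (P : Type*) [Group P] extends PrefusionSystem P where
  comp_mem : ∀ {Q R S : Subgroup P} {φ : Q →* R} {ψ : R →* S},
    φ ∈ Hom Q R → ψ ∈ Hom R S → ψ.comp φ ∈ Hom Q S
  conj_mem : ∀ (Q R : Subgroup P) (g : P) (h : ∀ x ∈ Q, g⁻¹ * x * g ∈ R),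
    conjHom Q R g h ∈ Hom Q R
  toImage_mem : ∀ {Q R : Subgroup P} {φ : Q →* R},
    φ ∈ Hom Q R → toImage φ ∈ Hom Q (imageSubgroup φ)
  symm_mem : ∀ {Q R : Subgroup P} (e : Q ≃* R),
    e.toMonoidHom ∈ Hom Q R → e.symm.toMonoidHom ∈ Hom R Q

/-- For `φ : Q → R`, the subgroup `N_φ` of those `x ∈ N_P(Q)` for which there is
`y ∈ N_P(Qφ)` with `(g ^ x)φ = (gφ) ^ y` for all `g ∈ Q`. In the definition `g'` is `g ^ x`. -/
def extensionSubgroup {P : Type*} [Group P] {Q R : Subgroup P} (φ : Q →* R) : Subgroup P where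
  carrier := {x | x ∈ Subgroup.normalizer (Q : Set P) ∧
    ∃ y ∈ Subgroup.normalizer (imageSubgroup φ : Set P),
      ∀ g g' : Q, (g' : P) = x⁻¹ * g * x → (φ g' : P) = y⁻¹ * φ g * y}
  one_mem' := by
    refine ⟨one_mem _, 1, one_mem _, fun g g' h => ?_⟩
    have : g' = g := by ext; simpa using h
    simp [this]
  mul_mem' := by
    rintro a b ⟨ha, y, hy, h⟩ ⟨hb, z, hz, k⟩
    refine ⟨mul_mem ha hb, y * z, mul_mem hy hz, fun g g' e => ?_⟩
    have hm : a⁻¹ * g * a ∈ Q := (Subgroup.mem_normalizer_iff''.1 ha g).1 g.2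
    rw [k ⟨_, hm⟩ g' (by rw [e]; simp [mul_assoc]), h g ⟨_, hm⟩ rfl]
    simp [mul_assoc]
  inv_mem' := by
    rintro a ⟨ha, y, hy, h⟩
    refine ⟨inv_mem ha, y⁻¹, inv_mem hy, fun g g' e => ?_⟩
    rw [h g' g (by rw [e]; simp [mul_assoc])]
    simp [mul_assoc]

theorem le_extensionSubgroup {P : Type*} [Group P] {Q R : Subgroup P} (φ : Q →* R) :
    Q ≤ extensionSubgroup φ := by
  intro x hx
  refine ⟨Subgroup.le_normalizer hx, φ ⟨x, hx⟩,
    Subgroup.le_normalizer ⟨φ ⟨x, hx⟩, ⟨_, rfl⟩, rfl⟩, fun g g' e => ?_⟩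
  have : g' = (⟨x, hx⟩ : Q)⁻¹ * g * ⟨x, hx⟩ := by ext; simpa using e
  simp [this]

namespace FusionSystem

theorem inclusion_mem {P : Type*} [Group P] (F : FusionSystem P) {Q R : Subgroup P}
    (h : Q ≤ R) : Subgroup.inclusion h ∈ F.Hom Q R := by
  have := F.conj_mem Q R 1 (fun x hx => by simpa using h hx)
  convert this using 1
  ext x; simp [conjHom]

theorem id_mem {P : Type*} [Group P] (F : FusionSystem P) (Q : Subgroup P) :
    MonoidHom.id Q ∈ F.Hom Q Q :=
  F.inclusion_mem le_rfl

/-- Codomains may be changed freely. -/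
theorem mem_of_eq {P : Type*} [Group P] (F : FusionSystem P) {Q R S : Subgroup P}
    {φ : Q →* R} (hφ : φ ∈ F.Hom Q R) (ψ : Q →* S) (h : ∀ x, (ψ x : P) = φ x) :
    ψ ∈ F.Hom Q S := by
  have hle : imageSubgroup φ ≤ S := by
    rintro _ ⟨_, ⟨x, rfl⟩, rfl⟩
    have := h x
    simp only [Subgroup.coe_subtype]
    rw [← this]; exact (ψ x).2
  convert F.comp_mem (F.toImage_mem hφ) (F.inclusion_mem hle) using 1
  ext x; exact h x

/-- `Aut_F(Q)`, as a group of automorphisms of `Q`. -/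
def aut {P : Type*} [Group P] (F : FusionSystem P) (Q : Subgroup P) : Subgroup (MulAut Q) where
  carrier := {e | MulEquiv.toMonoidHom e ∈ F.Hom Q Q}
  one_mem' := F.id_mem Q
  mul_mem' {_ _} ha hb := F.comp_mem hb ha
  inv_mem' {a} ha := F.symm_mem a ha

/-- `Q` is fully normalized: `|N_P(R)| ≤ |N_P(Q)|` for every isomorphism `Q → R` in `F`. -/
def IsFullyNormalized {P : Type*} [Group P] (F : FusionSystem P) (Q : Subgroup P) : Prop :=
  ∀ (R : Subgroup P) (e : Q ≃* R), e.toMonoidHom ∈ F.Hom Q R →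
    Nat.card (Subgroup.normalizer (R : Set P)) ≤ Nat.card (Subgroup.normalizer (Q : Set P))

/-- Saturation of a fusion system on a finite `p`-group `P`. The subgroup `⊤` is `P` itself, and
the range of `Subgroup.normalizerMonoidHom ⊤` is `Aut_P(P)`. -/
structure IsSaturated {P : Type*} [Group P] (p : ℕ) (F : FusionSystem P) : Prop where
  sylow : ∃ S : Sylow p (F.aut ⊤),
    (S : Subgroup (F.aut ⊤)).map (F.aut ⊤).subtype =
      (Subgroup.normalizerMonoidHom (⊤ : Subgroup P)).range
  extend : ∀ (Q : Subgroup P) (φ : Q →* (⊤ : Subgroup P)), φ ∈ F.Hom Q ⊤ →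
    F.IsFullyNormalized (imageSubgroup φ) →
    ∃ ψ ∈ F.Hom (extensionSubgroup φ) ⊤, ψ.comp (Subgroup.inclusion (le_extensionSubgroup φ)) = φ

/-- `Q` is strongly `F`-closed: every morphism in `F` whose domain is a subgroup of `Q` has image
a subgroup of `Q`. -/
def IsStronglyClosed {P : Type*} [Group P] (F : FusionSystem P) (Q : Subgroup P) : Prop :=
  ∀ (R S : Subgroup P) (φ : R →* S), φ ∈ F.Hom R S → R ≤ Q → imageSubgroup φ ≤ Q

theorem IsStronglyClosed.normal {P : Type*} [Group P] {F : FusionSystem P} {Q : Subgroup P}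
    (hQ : F.IsStronglyClosed Q) : Q.Normal := by
  refine ⟨fun n hn g => ?_⟩
  have := hQ _ _ _ (F.conj_mem Q ⊤ g⁻¹ (fun _ _ => trivial)) le_rfl ⟨_, ⟨⟨n, hn⟩, rfl⟩, rfl⟩
  simpa [conjHom] using this

theorem IsStronglyClosed.mem_iff {P : Type*} [Group P] {F : FusionSystem P} {Q : Subgroup P}
    (hQ : F.IsStronglyClosed Q) {R S : Subgroup P} {φ : R →* S} (hφ : φ ∈ F.Hom R S) (r : R) :
    (φ r : P) ∈ Q ↔ (r : P) ∈ Q := by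
  constructor
  · intro h
    have hb : Function.Bijective (toImage φ) := by
      refine ⟨F.injective _ (F.toImage_mem hφ), ?_⟩
      rintro ⟨_, _, ⟨x, rfl⟩, rfl⟩
      exact ⟨x, rfl⟩
    let e := MulEquiv.ofBijective (toImage φ) hb
    have he : e.symm.toMonoidHom ∈ F.Hom _ _ := F.symm_mem e (F.toImage_mem hφ)
    have hle : Subgroup.zpowers (φ r : P) ≤ imageSubgroup φ := by
      rw [Subgroup.zpowers_le]; exact ⟨φ r, ⟨r, rfl⟩, rfl⟩
    have key := hQ _ _ _ (F.comp_mem (F.inclusion_mem hle) he) (by rwa [Subgroup.zpowers_le])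
    apply key
    refine ⟨r, ⟨⟨(φ r : P), Subgroup.mem_zpowers _⟩, ?_⟩, rfl⟩
    change e.symm _ = r
    rw [MulEquiv.symm_apply_eq]; rfl
  · intro h
    have hle : Subgroup.zpowers (r : P) ≤ R := by rw [Subgroup.zpowers_le]; exact r.2
    exact hQ _ _ _ (F.comp_mem (F.inclusion_mem hle) hφ) (by rwa [Subgroup.zpowers_le])
      ⟨_, ⟨⟨(r : P), Subgroup.mem_zpowers _⟩, rfl⟩, rfl⟩

end FusionSystem

/-- `ψ : A → B`, between subgroups of `P ⧸ Q`, is induced by `φ : R → S`: the image of `R` in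
`P ⧸ Q` is `A`, the image of `S` is `B`, and `(Qr)ψ = Q(rφ)` for all `r ∈ R`. -/
def IsInducedBy {P : Type*} [Group P] {Q : Subgroup P} [Q.Normal] {A B : Subgroup (P ⧸ Q)}
    (ψ : A →* B) {R S : Subgroup P} (φ : R →* S) : Prop :=
  R.map (QuotientGroup.mk' Q) = A ∧ S.map (QuotientGroup.mk' Q) = B ∧
    ∀ (r : R) (a : A), (a : P ⧸ Q) = QuotientGroup.mk' Q r →
      (ψ a : P ⧸ Q) = QuotientGroup.mk' Q (φ r)

theorem IsInducedBy.exists_rep {P : Type*} [Group P] {Q : Subgroup P} [Q.Normal]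
    {A B : Subgroup (P ⧸ Q)} {ψ : A →* B} {R S : Subgroup P} {φ : R →* S}
    (h : IsInducedBy ψ φ) (a : A) : ∃ r : R, (a : P ⧸ Q) = QuotientGroup.mk' Q r := by
  have : (a : P ⧸ Q) ∈ R.map (QuotientGroup.mk' Q) := h.1.symm ▸ a.2
  obtain ⟨r, hr, e⟩ := this
  exact ⟨⟨r, hr⟩, e.symm⟩

namespace FusionSystem

/-- The set of homomorphisms `A → B`, between subgroups of `P ⧸ Q`, induced by those morphisms
`φ : R → S` in `F`, with `R` and `S` containing `Q`, that satisfy `Qφ = Q`. -/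
def factorHom {P : Type*} [Group P] (F : FusionSystem P) (Q : Subgroup P) [Q.Normal]
    (A B : Subgroup (P ⧸ Q)) : Set (A →* B) :=
  {ψ | ∃ (R S : Subgroup P) (φ : R →* S), Q ≤ R ∧ Q ≤ S ∧ φ ∈ F.Hom R S ∧
    ((Q.subgroupOf R).map φ).map S.subtype = Q ∧ IsInducedBy ψ φ}

theorem eq_of_map_eq {P : Type*} [Group P] {Q : Subgroup P} [Q.Normal] {R S : Subgroup P}
    (hR : Q ≤ R) (hS : Q ≤ S)
    (h : R.map (QuotientGroup.mk' Q) = S.map (QuotientGroup.mk' Q)) : R = S := by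
  have := congrArg (Subgroup.comap (QuotientGroup.mk' Q)) h
  simpa [Subgroup.comap_map_eq, sup_eq_left.2 hR, sup_eq_left.2 hS] using this

theorem mem_of_map_eq {P : Type*} [Group P] {Q R S : Subgroup P} {φ : R →* S}
    (h : ((Q.subgroupOf R).map φ).map S.subtype = Q) {r : R} (hr : (r : P) ∈ Q) :
    (φ r : P) ∈ Q := by
  rw [← h]; exact ⟨φ r, ⟨r, hr, rfl⟩, rfl⟩

theorem exists_of_map_eq {P : Type*} [Group P] {Q R S : Subgroup P} {φ : R →* S}
    (h : ((Q.subgroupOf R).map φ).map S.subtype = Q) {q : P} (hq : q ∈ Q) :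
    ∃ r : R, (r : P) ∈ Q ∧ (φ r : P) = q := by
  rw [← h] at hq
  obtain ⟨_, ⟨r, hr, rfl⟩, rfl⟩ := hq
  exact ⟨r, hr, rfl⟩

theorem map_eq_of {P : Type*} [Group P] {Q R S : Subgroup P} {φ : R →* S}
    (h₁ : ∀ r : R, (r : P) ∈ Q → (φ r : P) ∈ Q)
    (h₂ : ∀ q ∈ Q, ∃ r : R, (r : P) ∈ Q ∧ (φ r : P) = q) :
    ((Q.subgroupOf R).map φ).map S.subtype = Q := by
  ext q
  constructor
  · rintro ⟨_, ⟨r, hr, rfl⟩, rfl⟩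
    exact h₁ r hr
  · intro hq
    obtain ⟨r, hr, rfl⟩ := h₂ q hq
    exact ⟨φ r, ⟨r, hr, rfl⟩, rfl⟩

/-- The factor system `F/Q`, a fusion system on `P ⧸ Q`. -/
def factorSystem {P : Type*} [Group P] (F : FusionSystem P) (Q : Subgroup P) [Q.Normal] :
    FusionSystem (P ⧸ Q) where
  Hom := F.factorHom Q
  injective := by
    rintro A B ψ ⟨R, S, φ, hR, hS, hφ, hQ, hi⟩
    rw [injective_iff_map_eq_one]
    intro a ha
    obtain ⟨r, hr⟩ := hi.exists_rep a
    have h := hi.2.2 r a hr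
    rw [ha] at h
    have h' : (φ r : P) ∈ Q := by
      rw [← QuotientGroup.eq_one_iff]; exact h.symm
    obtain ⟨r', hr', e⟩ := exists_of_map_eq hQ h'
    have : r' = r := F.injective φ hφ (Subtype.ext e)
    subst this
    ext
    rw [hr]
    exact (QuotientGroup.eq_one_iff _).2 hr'
  comp_mem := by
    rintro A B C ψ₁ ψ₂ ⟨R, S, φ₁, hR, hS, hφ₁, hQ₁, hi₁⟩ ⟨S', T, φ₂, hS', hT, hφ₂, hQ₂, hi₂⟩
    obtain rfl : S = S' := eq_of_map_eq hS hS' (hi₁.2.1.trans hi₂.1.symm)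
    refine ⟨R, T, φ₂.comp φ₁, hR, hT, F.comp_mem hφ₁ hφ₂, ?_, hi₁.1, hi₂.2.1, ?_⟩
    · refine map_eq_of (fun r hr => mem_of_map_eq hQ₂ (mem_of_map_eq hQ₁ hr)) fun q hq => ?_
      obtain ⟨s, hs, rfl⟩ := exists_of_map_eq hQ₂ hq
      obtain ⟨r, hr, e⟩ := exists_of_map_eq hQ₁ hs
      exact ⟨r, hr, by rw [MonoidHom.comp_apply, Subtype.ext e]⟩
    · intro r a e
      exact hi₂.2.2 _ _ (hi₁.2.2 _ _ e)
  conj_mem := by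
    intro A B g h
    obtain ⟨g, rfl⟩ := QuotientGroup.mk'_surjective Q g
    have hc : ∀ x ∈ A.comap (QuotientGroup.mk' Q), g⁻¹ * x * g ∈ B.comap (QuotientGroup.mk' Q) :=
      fun x hx => by simpa using h _ hx
    have hle : ∀ C : Subgroup (P ⧸ Q), Q ≤ C.comap (QuotientGroup.mk' Q) := by
      intro C x hx
      have : QuotientGroup.mk' Q x = 1 := (QuotientGroup.eq_one_iff x).2 hx
      rw [Subgroup.mem_comap, this]; exact one_mem _
    refine ⟨_, _, conjHom _ _ g hc, hle A, hle B, F.conj_mem _ _ g hc, ?_, ?_, ?_, ?_⟩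
    · refine map_eq_of (fun r hr => ?_) fun q hq => ?_
      · have := Subgroup.Normal.conj_mem ‹Q.Normal› _ hr g⁻¹
        simpa [conjHom] using this
      · have := Subgroup.Normal.conj_mem ‹Q.Normal› _ hq g
        exact ⟨⟨_, hle A this⟩, this, by simp [conjHom, mul_assoc]⟩
    · exact Subgroup.map_comap_eq_self_of_surjective (QuotientGroup.mk'_surjective Q) A
    · exact Subgroup.map_comap_eq_self_of_surjective (QuotientGroup.mk'_surjective Q) B
    · intro r a e
      simp [conjHom, e]
  toImage_mem := by
    rintro A B ψ ⟨R, S, φ, hR, hS, hφ, hQ, hi⟩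
    refine ⟨R, imageSubgroup φ, toImage φ, hR, ?_, F.toImage_mem hφ, ?_, hi.1, ?_, ?_⟩
    · intro q hq
      obtain ⟨r, _, rfl⟩ := exists_of_map_eq hQ hq
      exact ⟨φ r, ⟨r, rfl⟩, rfl⟩
    · exact map_eq_of (fun r hr => mem_of_map_eq hQ hr) fun q hq => exists_of_map_eq hQ hq
    · ext x
      constructor
      · rintro ⟨_, ⟨_, ⟨r, rfl⟩, rfl⟩, rfl⟩
        have ha : QuotientGroup.mk' Q r ∈ A := by rw [← hi.1]; exact ⟨r, r.2, rfl⟩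
        exact ⟨ψ ⟨_, ha⟩, ⟨_, rfl⟩, hi.2.2 r ⟨_, ha⟩ rfl⟩
      · rintro ⟨_, ⟨a, rfl⟩, rfl⟩
        obtain ⟨r, hr⟩ := hi.exists_rep a
        exact ⟨φ r, ⟨φ r, ⟨r, rfl⟩, rfl⟩, (hi.2.2 r a hr).symm⟩
    · intro r a e
      exact hi.2.2 r a e
  symm_mem := by
    rintro A B e ⟨R, S, φ, hR, hS, hφ, hQ, hi⟩
    have hb : Function.Bijective φ := by
      refine ⟨F.injective φ hφ, fun s => ?_⟩
      have hs : QuotientGroup.mk' Q s ∈ B := by rw [← hi.2.1]; exact ⟨s, s.2, rfl⟩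
      obtain ⟨r, hr⟩ := hi.exists_rep (e.symm ⟨_, hs⟩)
      have h := hi.2.2 r _ hr
      have h' : (QuotientGroup.mk' Q s) = QuotientGroup.mk' Q (φ r) := by
        rw [← h]
        change _ = ((e (e.symm ⟨_, hs⟩) : B) : P ⧸ Q)
        rw [MulEquiv.apply_symm_apply]
      have hq : (φ r : P)⁻¹ * s ∈ Q := QuotientGroup.eq.1 h'.symm
      obtain ⟨r', -, e'⟩ := exists_of_map_eq hQ hq
      refine ⟨r * r', Subtype.ext ?_⟩
      simp [e']
    let f := MulEquiv.ofBijective φ hb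
    refine ⟨S, R, f.symm.toMonoidHom, hS, hR, F.symm_mem f hφ, ?_, hi.2.1, hi.1, ?_⟩
    · refine map_eq_of (fun s hs => ?_) fun q hq => ?_
      · obtain ⟨r, hr, e'⟩ := exists_of_map_eq hQ hs
        have : f.symm s = r := by rw [MulEquiv.symm_apply_eq]; exact Subtype.ext e'.symm
        change ((f.symm s : R) : P) ∈ Q
        rwa [this]
      · refine ⟨φ ⟨q, hR hq⟩, mem_of_map_eq hQ hq, ?_⟩
        change ((f.symm (f ⟨q, hR hq⟩) : R) : P) = q
        rw [MulEquiv.symm_apply_apply]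
    · intro s b hs
      change ((e.symm b : A) : P ⧸ Q) = QuotientGroup.mk' Q (f.symm s : R)
      have ha : QuotientGroup.mk' Q (f.symm s : R) ∈ A := by
        rw [← hi.1]; exact ⟨_, (f.symm s).2, rfl⟩
      have h := hi.2.2 (f.symm s) ⟨_, ha⟩ rfl
      have h2 : φ (f.symm s) = s := f.apply_symm_apply s
      have h3 : e ⟨_, ha⟩ = b := Subtype.ext (by rw [hs]; rw [h2] at h; exact h)
      rw [← h3, MulEquiv.symm_apply_apply]

/-- For `Q` strongly `F`-closed, the prefusion system on `P ⧸ Q` consisting of the homomorphisms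
induced by all morphisms `φ : R' → S'` of `F`, where `R'` and `S'` range over all subgroups of
`P`; such a `φ` induces a map from `R'Q/Q` to `S'Q/Q`. -/
def barSystem {P : Type*} [Group P] (F : FusionSystem P) (Q : Subgroup P) [Q.Normal]
    (hQ : F.IsStronglyClosed Q) : PrefusionSystem (P ⧸ Q) where
  Hom A B := {ψ | ∃ (R' S' : Subgroup P) (φ : R' →* S'), φ ∈ F.Hom R' S' ∧ IsInducedBy ψ φ}
  injective := by
    rintro A B ψ ⟨R, S, φ, hφ, hi⟩
    rw [injective_iff_map_eq_one]
    intro a ha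
    obtain ⟨r, hr⟩ := hi.exists_rep a
    have h := hi.2.2 r a hr
    rw [ha] at h
    have h' : (φ r : P) ∈ Q := by
      rw [← QuotientGroup.eq_one_iff]; exact h.symm
    ext
    rw [hr]
    exact (QuotientGroup.eq_one_iff _).2 ((hQ.mem_iff hφ r).1 h')

/-- A morphism of fusion systems `F → E`: a homomorphism of the underlying groups, and maps
`Hom_F(R, S) → Hom_E(RΦ, SΦ)` that form a functor. -/
structure Morphism {P P' : Type*} [Group P] [Group P'] (F : FusionSystem P)
    (E : FusionSystem P') where
  toHom : P →* P'
  map : ∀ (R S : Subgroup P), F.Hom R S → E.Hom (R.map toHom) (S.map toHom)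
  map_id : ∀ R : Subgroup P,
    (map R R ⟨MonoidHom.id R, F.id_mem R⟩ : R.map toHom →* R.map toHom) = MonoidHom.id _
  map_comp : ∀ (R S T : Subgroup P) (α : F.Hom R S) (β : F.Hom S T),
    (map R T ⟨(β : S →* T).comp (α : R →* S), F.comp_mem α.2 β.2⟩ : R.map toHom →* T.map toHom) =
      (map S T β : S.map toHom →* T.map toHom).comp (map R S α : R.map toHom →* S.map toHom)

end FusionSystem

/-! The heart is `IsIso.liftable`: every F-isomorphism U → V agrees modulo Q with an F-isomorphism
UQ → VQ. Hence a map induced by an arbitrary morphism is also induced by one between subgroups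
containing Q, and strong closure makes that morphism send Q onto Q. The natural morphism follows,
since induced maps exist and are unique.

Lifting goes by downward induction on |U|; a map that extends, modulo Q, to a larger subgroup lifts
by induction. Through a fully normalized conjugate W, an isomorphism factors as α, then a ∈
Aut_F(W), then β⁻¹, where α : U → W and β : V → W extend to N_P(U) and N_P(V). If Q ≤ W, then a is
its own lift. Otherwise let K be the normal subgroup of Aut_F(W) acting trivially modulo Q. It
contains the automorphisms induced by N_Q(W), and a Sylow argument yields k ∈ K such that a followed
by k carries these into Aut_P(W). The corrected map extends to W N_Q(W) > W
(`IsFullyNormalized.exists_extension_mod`).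

The Sylow arguments need Aut_P(W) to be Sylow in Aut_F(W) for W fully normalized. Saturation grants
this only for W = P; `IsFullyNormalized.isFullyAutomized` derives the rest. -/

/-! ### Finite group theory: normalizers and Sylow subgroups. -/

theorem IsPGroup.exists_mem_normalizer_notMem {p : ℕ} [Fact p.Prime] {G : Type*} [Group G]
    [Finite G] {H L : Subgroup G} (hL : IsPGroup p L) (hlt : H < L) :
    ∃ x ∈ L, x ∉ H ∧ x ∈ Subgroup.normalizer (H : Set G) := by
  have := hL.isNilpotent
  have hne : H.subgroupOf L < ⊤ := by
    rw [lt_top_iff_ne_top, Ne, Subgroup.subgroupOf_eq_top]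
    exact not_le_of_gt hlt
  obtain ⟨x, hx, hx'⟩ :=
    SetLike.exists_of_lt (Group.normalizerCondition_of_isNilpotent (G := L) _ hne)
  refine ⟨x, x.2, hx', Subgroup.mem_normalizer_iff.2 fun h => ⟨fun hh => ?_, fun hh => ?_⟩⟩
  · exact (Subgroup.mem_normalizer_iff.1 hx ⟨h, hlt.le hh⟩).1 hh
  · have hm : h ∈ L := by
      have := mul_mem (mul_mem (inv_mem x.2) (hlt.le hh)) x.2
      simpa [mul_assoc] using this
    exact (Subgroup.mem_normalizer_iff.1 hx ⟨h, hm⟩).2 hh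

/-- A `p`-subgroup containing every `p`-element that normalizes it is a Sylow `p`-subgroup. -/
theorem IsPGroup.exists_sylow_eq_of_normalizer {p : ℕ} [Fact p.Prime] {G : Type*} [Group G]
    [Finite G] {S : Subgroup G} (hS : IsPGroup p S)
    (h : ∀ g ∈ Subgroup.normalizer (S : Set G), (∃ k, g ^ p ^ k = 1) → g ∈ S) :
    ∃ T : Sylow p G, (T : Subgroup G) = S := by
  obtain ⟨T, hT⟩ := hS.exists_le_sylow
  refine ⟨T, ?_⟩
  by_contra hne
  obtain ⟨x, hxT, hxS, hx⟩ := T.isPGroup'.exists_mem_normalizer_notMem (lt_of_le_of_ne hT (Ne.symm hne))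
  obtain ⟨k, hk⟩ := isPGroup_iff_pow_pow_eq_one.1 T.isPGroup' ⟨x, hxT⟩
  exact hxS (h x hx ⟨k, by simpa [Subtype.ext_iff] using hk⟩)

theorem Sylow.exists_conj_mem {p : ℕ} [Fact p.Prime] {G : Type*} [Group G] [Finite G]
    (S : Sylow p G) {T : Subgroup G} (hT : IsPGroup p T) :
    ∃ g : G, ∀ t ∈ T, g * t * g⁻¹ ∈ S := by
  obtain ⟨T', hT'⟩ := hT.exists_le_sylow
  obtain ⟨g, rfl⟩ := MulAction.exists_smul_eq G T' S
  exact ⟨g, fun t ht => Subgroup.smul_mem_pointwise_smul _ (MulAut.conj g) _ (hT' ht)⟩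

/-- S is Sylow in SK, so some sk conjugates T into S; the factor s normalizes S and can be dropped.
Keeping the conjugator in K is what later makes a correction invisible modulo Q. -/
theorem Sylow.exists_conj_mem_of_le_normal {p : ℕ} [Fact p.Prime] {G : Type*} [Group G] [Finite G]
    (S : Sylow p G) {K T : Subgroup G} [K.Normal] (hT : IsPGroup p T) (hTK : T ≤ K) :
    ∃ k ∈ K, ∀ t ∈ T, k * t * k⁻¹ ∈ S := by
  have hTH : T ≤ (S : Subgroup G) ⊔ K := hTK.trans le_sup_right
  have hT' : IsPGroup p (T.subgroupOf ((S : Subgroup G) ⊔ K)) :=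
    hT.of_equiv (Subgroup.subgroupOfEquivOfLe hTH).symm
  obtain ⟨⟨g, hg⟩, h⟩ := (S.subtype (N := (S : Subgroup G) ⊔ K) le_sup_left).exists_conj_mem hT'
  obtain ⟨s, hs, k, hk, rfl⟩ := Subgroup.mem_sup_of_normal_right.1 hg
  refine ⟨k, hk, fun t ht => ?_⟩
  have h1 : s * k * t * (s * k)⁻¹ ∈ (S : Subgroup G) := h ⟨t, hTH ht⟩ ht
  have := mul_mem (mul_mem (inv_mem hs) h1) hs
  change k * t * k⁻¹ ∈ (S : Subgroup G)
  simpa [mul_assoc] using this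

/-- Some power `g ^ m` with `m ≡ 1` modulo `p ^ k` is a `p`-element. -/
theorem exists_modEq_one_pow_eq_one {p : ℕ} [Fact p.Prime] {G : Type*} [Group G] [Finite G]
    (g : G) (k : ℕ) : ∃ m, m ≡ 1 [MOD p ^ k] ∧ ∃ j, (g ^ m) ^ p ^ j = 1 := by
  obtain ⟨j, r, hr, e⟩ := Nat.exists_eq_pow_mul_and_not_dvd (orderOf_pos g).ne' p
    (Fact.out : p.Prime).ne_one
  have hc : Nat.Coprime (p ^ k) r :=
    Nat.Coprime.pow_left _ (((Fact.out : p.Prime).coprime_iff_not_dvd).2 hr)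
  -- Divisibility by the p'-part r of the order makes g ^ m a p-element.
  obtain ⟨m, h1, h2⟩ := Nat.chineseRemainder hc 1 0
  refine ⟨m, h1, j, ?_⟩
  obtain ⟨c, rfl⟩ := (Nat.modEq_zero_iff_dvd.1 h2)
  rw [← pow_mul, show r * c * p ^ j = orderOf g * c by rw [e]; ring, pow_mul, pow_orderOf_eq_one,
    one_pow]

/-! ### Isomorphisms in a fusion system and the extension axiom. -/

namespace FusionSystem

/-- An isomorphism between subgroups of `P` that belongs to `F`. -/
def IsIso {P : Type*} [Group P] (F : FusionSystem P) {U V : Subgroup P} (e : U ≃* V) : Prop :=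
  e.toMonoidHom ∈ F.Hom U V

section

variable {P : Type*} [Group P] {F : FusionSystem P}

theorem IsIso.refl (U : Subgroup P) : F.IsIso (MulEquiv.refl U) := F.id_mem U

theorem IsIso.trans {U V W : Subgroup P} {e : U ≃* V} {f : V ≃* W} (he : F.IsIso e)
    (hf : F.IsIso f) : F.IsIso (e.trans f) := F.comp_mem he hf

theorem IsIso.symm {U V : Subgroup P} {e : U ≃* V} (he : F.IsIso e) : F.IsIso e.symm :=
  F.symm_mem e he

theorem exists_isIso_image {R S : Subgroup P} {φ : R →* S} (hφ : φ ∈ F.Hom R S) :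
    ∃ e : R ≃* imageSubgroup φ, F.IsIso e ∧ ∀ r, (e r : P) = φ r := by
  have hb : Function.Bijective (toImage φ) := by
    refine ⟨F.injective _ (F.toImage_mem hφ), ?_⟩
    rintro ⟨_, _, ⟨x, rfl⟩, rfl⟩
    exact ⟨x, rfl⟩
  exact ⟨MulEquiv.ofBijective (toImage φ) hb, F.toImage_mem hφ, fun _ => rfl⟩

theorem exists_isIso_restrict {R S U V : Subgroup P} {φ : R →* S} (hφ : φ ∈ F.Hom R S)
    (hU : U ≤ R) (h₁ : ∀ u (hu : u ∈ U), (φ ⟨u, hU hu⟩ : P) ∈ V)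
    (h₂ : ∀ v ∈ V, ∃ u, ∃ hu : u ∈ U, (φ ⟨u, hU hu⟩ : P) = v) :
    ∃ e : U ≃* V, F.IsIso e ∧ ∀ u : U, (e u : P) = φ ⟨u, hU u.2⟩ := by
  obtain ⟨e, he, hr⟩ := exists_isIso_image (F.comp_mem (F.inclusion_mem hU) hφ)
  have : imageSubgroup (φ.comp (Subgroup.inclusion hU)) = V := by
    ext v
    constructor
    · rintro ⟨_, ⟨u, rfl⟩, rfl⟩
      exact h₁ u u.2
    · intro hv
      obtain ⟨u, hu, rfl⟩ := h₂ v hv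
      exact ⟨_, ⟨⟨u, hu⟩, rfl⟩, rfl⟩
  subst this
  exact ⟨e, he, hr⟩

theorem exists_isIso_restrict_of_card_le [Finite P] {R S U V : Subgroup P} {φ : R →* S}
    (hφ : φ ∈ F.Hom R S) (hU : U ≤ R) (h : ∀ u (hu : u ∈ U), (φ ⟨u, hU hu⟩ : P) ∈ V)
    (hc : Nat.card V ≤ Nat.card U) :
    ∃ e : U ≃* V, F.IsIso e ∧ ∀ u : U, (e u : P) = φ ⟨u, hU u.2⟩ := by
  refine exists_isIso_restrict hφ hU h fun v hv => ?_
  let f : U → V := fun u => ⟨_, h u u.2⟩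
  have hf : Function.Injective f := by
    intro a b hab
    have hab' := F.injective _ hφ (Subtype.ext (Subtype.mk.inj hab))
    exact Subtype.ext (Subtype.mk.inj hab')
  obtain ⟨u, hu⟩ := (hf.bijective_of_nat_card_le hc).2 ⟨v, hv⟩
  exact ⟨u, u.2, Subtype.ext_iff.1 hu⟩

theorem normalizerMonoidHom_mem_aut (U : Subgroup P) (x : Subgroup.normalizer (U : Set P)) :
    U.normalizerMonoidHom x ∈ F.aut U := by
  refine F.mem_of_eq (F.conj_mem U ⊤ x⁻¹ fun _ _ => trivial) _ fun u => ?_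
  simp [conjHom]

/-- `Aut_P(U)`, as a subgroup of `Aut_F(U)`. -/
def conjAut (F : FusionSystem P) (U : Subgroup P) : Subgroup (F.aut U) :=
  U.normalizerMonoidHom.range.subgroupOf (F.aut U)

theorem mem_conjAut {U : Subgroup P} {a : F.aut U} :
    a ∈ F.conjAut U ↔ ∃ x ∈ Subgroup.normalizer (U : Set P),
      ∀ u : U, ((a : MulAut U) u : P) = x * u * x⁻¹ := by
  constructor
  · rintro ⟨x, hx⟩
    refine ⟨x, x.2, fun u => ?_⟩
    change U.normalizerMonoidHom x = a at hx
    simp [← hx]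
  · rintro ⟨x, hx, h⟩
    refine ⟨⟨x, hx⟩, MulEquiv.ext fun u => Subtype.ext ?_⟩
    simpa using (h u).symm

/-- `Aut_P(U)` is a Sylow `p`-subgroup of `Aut_F(U)`. -/
def IsFullyAutomized (p : ℕ) (F : FusionSystem P) (U : Subgroup P) : Prop :=
  ∃ S : Sylow p (F.aut U), (S : Subgroup (F.aut U)) = F.conjAut U

theorem isPGroup_conjAut {p : ℕ} (hP : IsPGroup p P) (U : Subgroup P) :
    IsPGroup p (F.conjAut U) := by
  have : IsPGroup p U.normalizerMonoidHom.range :=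
    (hP.to_subgroup _).of_surjective _ U.normalizerMonoidHom.rangeRestrict_surjective
  exact this.comap_of_injective _ Subtype.val_injective

theorem IsSaturated.isFullyAutomized_top {p : ℕ} (hF : F.IsSaturated p) :
    F.IsFullyAutomized p ⊤ := by
  obtain ⟨S, hS⟩ := hF.sylow
  refine ⟨S, ?_⟩
  rw [conjAut, ← hS, Subgroup.subgroupOf,
    Subgroup.comap_map_eq_self_of_injective (Subgroup.subtype_injective _)]

/-- The extension axiom in working form: for an isomorphism onto V, for any M inside N_φ, and with
conjugation on the left to match `MulAut`. -/
theorem IsSaturated.exists_extension {p : ℕ} (hF : F.IsSaturated p) {U V : Subgroup P}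
    {e : U ≃* V} (he : F.IsIso e) (hV : F.IsFullyNormalized V) {M : Subgroup P} (hM : U ≤ M)
    (h : ∀ x ∈ M, x ∈ Subgroup.normalizer (U : Set P) ∧
      ∃ y ∈ Subgroup.normalizer (V : Set P), ∀ g g' : U, (g' : P) = x * g * x⁻¹ →
        (e g' : P) = y * e g * y⁻¹) :
    ∃ ψ ∈ F.Hom M ⊤, ∀ u (hu : u ∈ U), (ψ ⟨u, hM hu⟩ : P) = e ⟨u, hu⟩ := by
  let φ : U →* (⊤ : Subgroup P) := (Subgroup.inclusion le_top).comp e.toMonoidHom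
  have hφ : φ ∈ F.Hom U ⊤ := F.comp_mem he (F.inclusion_mem le_top)
  have him : imageSubgroup φ = V := by
    ext v
    constructor
    · rintro ⟨_, ⟨u, rfl⟩, rfl⟩
      exact (e u).2
    · intro hv
      exact ⟨_, ⟨e.symm ⟨v, hv⟩, rfl⟩, by simp [φ]⟩
  obtain ⟨ψ, hψ, hr⟩ := hF.extend U φ hφ (by rwa [him])
  have hle : M ≤ extensionSubgroup φ := by
    intro x hx
    obtain ⟨hx', -⟩ := h x hx
    -- Inverting x and y passes between left and right conjugation.
    obtain ⟨-, y, hy, hy'⟩ := h x⁻¹ (inv_mem hx)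
    refine ⟨hx', y⁻¹, by rw [him]; exact inv_mem hy, fun g g' hg => ?_⟩
    have := hy' g g' (by simpa using hg)
    simpa [φ] using this
  refine ⟨ψ.comp (Subgroup.inclusion hle), F.comp_mem (F.inclusion_mem hle) hψ, fun u hu => ?_⟩
  have := DFunLike.congr_fun hr ⟨u, hu⟩
  exact Subtype.ext_iff.1 this

theorem exists_isFullyNormalized [Finite P] (U : Subgroup P) :
    ∃ (V : Subgroup P) (e : U ≃* V), F.IsIso e ∧ F.IsFullyNormalized V := by
  let C : Set (Subgroup P) := {V | ∃ e : U ≃* V, F.IsIso e}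
  obtain ⟨V, ⟨e, he⟩, hmax⟩ := Set.exists_max_image C
    (fun V => Nat.card (Subgroup.normalizer (V : Set P))) (Set.toFinite _)
    ⟨U, MulEquiv.refl U, IsIso.refl U⟩
  exact ⟨V, e, he, fun W f hf => hmax W ⟨e.trans f, he.trans hf⟩⟩

theorem IsIso.congr_mem_aut {U V : Subgroup P} {e : U ≃* V} (he : F.IsIso e) {a : MulAut U}
    (ha : a ∈ F.aut U) : MulAut.congr e a ∈ F.aut V :=
  he.symm.trans (IsIso.trans (e := a) ha he)

/-- Transport of automorphism groups along an isomorphism in `F`. -/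
def IsIso.autMap {U V : Subgroup P} {e : U ≃* V} (he : F.IsIso e) : F.aut U →* F.aut V :=
  ((MulAut.congr e).toMonoidHom.comp (F.aut U).subtype).codRestrict _ fun a =>
    he.congr_mem_aut a.2

theorem IsIso.autMap_apply {U V : Subgroup P} {e : U ≃* V} (he : F.IsIso e) (a : F.aut U)
    (u : U) : (he.autMap a : MulAut V) (e u) = e ((a : MulAut U) u) := by
  change e ((a : MulAut U) (e.symm (e u))) = _
  rw [MulEquiv.symm_apply_apply]

/-- If `V` is fully automized, an isomorphism `U → V` can be corrected by an automorphism of `V`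
so as to carry a given `p`-group of automorphisms of `U` into `Aut_P(V)`. -/
theorem IsIso.exists_forall_conj {p : ℕ} [Fact p.Prime] [Finite P] {U V : Subgroup P}
    {e : U ≃* V} (he : F.IsIso e) (hV : F.IsFullyAutomized p V) {T : Subgroup (F.aut U)}
    (hT : IsPGroup p T) :
    ∃ f : U ≃* V, F.IsIso f ∧ ∀ t ∈ T, ∃ y ∈ Subgroup.normalizer (V : Set P),
      ∀ u, (f ((t : MulAut U) u) : P) = y * f u * y⁻¹ := by
  obtain ⟨S, hS⟩ := hV
  -- Sylow's theorem in Aut_F(V), applied to T transported along e; the correction is g.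
  obtain ⟨g, hg⟩ := S.exists_conj_mem (hT.map he.autMap)
  refine ⟨e.trans (g : MulAut V), he.trans (f := (g : MulAut V)) g.2, fun t ht => ?_⟩
  have h1 : g * he.autMap t * g⁻¹ ∈ (S : Subgroup (F.aut V)) := hg _ ⟨t, ht, rfl⟩
  rw [hS, mem_conjAut] at h1
  obtain ⟨y, hy, h⟩ := h1
  refine ⟨y, hy, fun u => ?_⟩
  have h2 := h ((g : MulAut V) (e u))
  rw [MulEquiv.trans_apply, MulEquiv.trans_apply, ← h2, ← he.autMap_apply]
  simp [MulAut.mul_apply]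

end

/-! ### Fully normalized subgroups are fully automized. -/

section

variable {P : Type*} [Group P] {F : FusionSystem P}

/-- Once e is corrected to carry Aut_P(U) into Aut_P(V), its extension subgroup is all of N_P(U). -/
theorem IsIso.exists_extension_normalizer {p : ℕ} [Fact p.Prime] [Finite P] (hP : IsPGroup p P)
    (hF : F.IsSaturated p) {U V : Subgroup P} {e : U ≃* V} (he : F.IsIso e)
    (hV : F.IsFullyNormalized V) (hV' : F.IsFullyAutomized p V) :
    ∃ f : U ≃* V, F.IsIso f ∧ ∃ ψ ∈ F.Hom (Subgroup.normalizer (U : Set P)) ⊤,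
      ∀ u (hu : u ∈ U), (ψ ⟨u, Subgroup.le_normalizer hu⟩ : P) = f ⟨u, hu⟩ := by
  obtain ⟨f, hf, h⟩ := he.exists_forall_conj hV' (isPGroup_conjAut hP U)
  refine ⟨f, hf, hF.exists_extension hf hV Subgroup.le_normalizer fun x hx => ⟨hx, ?_⟩⟩
  obtain ⟨y, hy, h'⟩ := h ⟨_, normalizerMonoidHom_mem_aut U ⟨x, hx⟩⟩
    (mem_conjAut.2 ⟨x, hx, fun u => by simp⟩)
  refine ⟨y, hy, fun g g' hg => ?_⟩
  rw [← h' g]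
  congr 2
  ext
  simp [hg]

theorem aut_pow_apply {U N : Subgroup P} (hUN : U ≤ N) {a : MulAut U} {b : MulAut N}
    (h : ∀ u : U, (b ⟨u, hUN u.2⟩ : P) = a u) (m : ℕ) (u : U) :
    ((b ^ m) ⟨u, hUN u.2⟩ : P) = (a ^ m) u := by
  induction m generalizing u with
  | zero => simp
  | succ m ih =>
    rw [pow_succ, pow_succ, MulAut.mul_apply, MulAut.mul_apply, ← ih]
    congr 2
    exact Subtype.ext (h u)

theorem exists_notMem_mem_normalizer {p : ℕ} [Fact p.Prime] [Finite P] (hP : IsPGroup p P)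
    {U V : Subgroup P} (h : U < V) :
    ∃ x ∈ V, x ∉ U ∧ x ∈ Subgroup.normalizer (U : Set P) :=
  (hP.to_subgroup V).exists_mem_normalizer_notMem h

theorem card_lt_card_normalizer {p : ℕ} [Fact p.Prime] [Finite P] (hP : IsPGroup p P)
    {U : Subgroup P} (h : U ≠ ⊤) : Nat.card U < Nat.card (Subgroup.normalizer (U : Set P)) := by
  obtain ⟨x, -, hx, hx'⟩ := exists_notMem_mem_normalizer hP h.lt_top
  exact Set.ncard_lt_ncard (s := (U : Set P)) (t := Subgroup.normalizer (U : Set P))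
    (SetLike.coe_ssubset_coe.2 (lt_of_le_of_ne Subgroup.le_normalizer fun e => hx (e ▸ hx')))
    (Set.toFinite _)

theorem IsIso.card_eq {U V : Subgroup P} {e : U ≃* V} (_he : F.IsIso e) :
    Nat.card U = Nat.card V := Nat.card_congr e.toEquiv

/-- A `p`-automorphism of a fully normalized subgroup that normalizes `Aut_P(U)` and extends to a
`p`-automorphism of `N_P(U)` belongs to `Aut_P(U)`, if the conjugates of `N_P(U)` that are fully
normalized are fully automized. -/
theorem IsFullyNormalized.mem_conjAut_of_extension {p : ℕ} [Fact p.Prime] [Finite P]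
    {U N' : Subgroup P} (hU : F.IsFullyNormalized U) {a : F.aut U}
    {b : F.aut (Subgroup.normalizer (U : Set P))}
    (hab : ∀ u : U, ((b : MulAut (Subgroup.normalizer (U : Set P))) ⟨u, Subgroup.le_normalizer u.2⟩ : P) = (a : MulAut U) u)
    (hb : ∃ j, b ^ p ^ j = 1) {e : Subgroup.normalizer (U : Set P) ≃* N'} (he : F.IsIso e)
    (hN' : F.IsFullyAutomized p N') : a ∈ F.conjAut U := by
  have hT : IsPGroup p (Subgroup.zpowers b) := by
    obtain ⟨j, hj⟩ := hb
    rintro ⟨_, n, rfl⟩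
    refine ⟨j, Subtype.ext ?_⟩
    change (b ^ n) ^ p ^ j = 1
    rw [← zpow_natCast, ← zpow_mul, mul_comm, zpow_mul, zpow_natCast, hj, one_zpow]
  obtain ⟨f, hf, h⟩ := he.exists_forall_conj hN' hT
  obtain ⟨y, hy, h⟩ := h b (Subgroup.mem_zpowers b)
  -- V is the image of U under f. The aim is N' = N_P(V), so that y, which normalizes V, comes from
  -- an element of N_P(U).
  let V : Subgroup P :=
    ((U.subgroupOf (Subgroup.normalizer (U : Set P))).map f.toMonoidHom).map N'.subtype
  have hfV : ∀ u (hu : u ∈ U), (f ⟨u, Subgroup.le_normalizer hu⟩ : P) ∈ V := fun u hu =>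
    ⟨_, ⟨⟨u, Subgroup.le_normalizer hu⟩, hu, rfl⟩, rfl⟩
  have hVf : ∀ v ∈ V, ∃ u, ∃ hu : u ∈ U, (f ⟨u, Subgroup.le_normalizer hu⟩ : P) = v := by
    rintro _ ⟨_, ⟨u, hu, rfl⟩, rfl⟩
    exact ⟨u, hu, rfl⟩
  obtain ⟨g, hg, -⟩ := exists_isIso_restrict hf Subgroup.le_normalizer hfV hVf
  have hle : N' ≤ Subgroup.normalizer (V : Set P) := by
    have hn : ∀ n ∈ N', ∀ v ∈ V, n * v * n⁻¹ ∈ V := by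
      intro n hn v hv
      obtain ⟨u, hu, rfl⟩ := hVf v hv
      obtain ⟨m, hm⟩ := f.surjective ⟨n, hn⟩
      have := hfV _ ((Subgroup.mem_normalizer_iff.1 m.2 u).1 hu)
      have e' : (⟨m * u * (m : P)⁻¹, Subgroup.le_normalizer
          ((Subgroup.mem_normalizer_iff.1 m.2 u).1 hu)⟩ : Subgroup.normalizer (U : Set P)) =
          m * ⟨u, Subgroup.le_normalizer hu⟩ * m⁻¹ := rfl
      rw [e', map_mul, map_mul, map_inv, hm] at this
      exact this
    exact fun n hn' => Subgroup.mem_normalizer_fintype (hn n hn')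
  -- V is F-conjugate to U, so full normalization of U bounds |N_P(V)| by |N_P(U)| = |N'|.
  have hNV : N' = Subgroup.normalizer (V : Set P) := by
    refine SetLike.coe_injective (Set.eq_of_subset_of_ncard_le hle ?_ (Set.toFinite _))
    have := hU V g hg
    rw [hf.card_eq] at this
    exact this
  -- Conjugation by y on N' corresponds under f to b, which preserves U because it extends a.
  have hyV : y ∈ Subgroup.normalizer (V : Set P) := by
    refine Subgroup.mem_normalizer_fintype fun v hv => ?_
    obtain ⟨u, hu, rfl⟩ := hVf v hv
    rw [← h]
    have := hfV _ ((a : MulAut U) ⟨u, hu⟩).2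
    rwa [show (⟨((a : MulAut U) ⟨u, hu⟩ : U), Subgroup.le_normalizer (SetLike.coe_mem _)⟩ :
      Subgroup.normalizer (U : Set P)) = (b : MulAut (Subgroup.normalizer (U : Set P))) ⟨u, Subgroup.le_normalizer hu⟩ from
      Subtype.ext (hab ⟨u, hu⟩).symm] at this
  obtain ⟨n, hn⟩ := f.surjective ⟨y, hNV ▸ hyV⟩
  refine mem_conjAut.2 ⟨n, n.2, fun u => ?_⟩
  have h1 := h ⟨u, Subgroup.le_normalizer u.2⟩
  have h2 : (b : MulAut (Subgroup.normalizer (U : Set P))) ⟨u, Subgroup.le_normalizer u.2⟩ =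
      n * ⟨u, Subgroup.le_normalizer u.2⟩ * n⁻¹ := by
    apply f.injective
    rw [map_mul, map_mul, map_inv, hn]
    exact Subtype.ext h1
  rw [← hab, h2]
  rfl

/-- Downward induction on |U|. It is enough that each p-element a normalizing Aut_P(U) lies in it.
Such an a extends to an automorphism of N_P(U), a suitable power of which is a p-element still
extending a; a fully normalized conjugate of N_P(U) is fully automized by induction. -/
theorem IsFullyNormalized.isFullyAutomized {p : ℕ} [Fact p.Prime] [Finite P]
    (hP : IsPGroup p P) (hF : F.IsSaturated p) {U : Subgroup P} (hU : F.IsFullyNormalized U) :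
    F.IsFullyAutomized p U := by
  induction hn : Nat.card P - Nat.card U using Nat.strong_induction_on generalizing U with
  | _ n ih =>
  subst hn
  by_cases htop : U = ⊤
  · subst htop
    exact hF.isFullyAutomized_top
  refine (isPGroup_conjAut hP U).exists_sylow_eq_of_normalizer fun a ha ⟨k, hk⟩ => ?_
  -- Since a normalizes Aut_P(U), its extension subgroup is all of N_P(U).
  obtain ⟨ψ, hψ, hψa⟩ := hF.exists_extension (e := (a : MulAut U)) a.2 hU
    (Subgroup.le_normalizer (H := U)) fun x hx => by
      have hc : (⟨_, normalizerMonoidHom_mem_aut U ⟨x, hx⟩⟩ : F.aut U) ∈ F.conjAut U :=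
        mem_conjAut.2 ⟨x, hx, fun u => by simp⟩
      obtain ⟨y, hy, h⟩ := mem_conjAut.1 ((Subgroup.mem_normalizer_iff.1 ha _).1 hc)
      refine ⟨hx, y, hy, fun g g' hg => ?_⟩
      rw [← h]
      simp only [Subgroup.coe_mul, Subgroup.coe_inv, MulAut.mul_apply, MulAut.inv_apply_self]
      congr 2
      ext
      simp [hg]
  -- ψ maps U onto itself, so it sends elements normalizing U to elements normalizing U.
  have hψN : ∀ x (hx : x ∈ Subgroup.normalizer (U : Set P)),
      (ψ ⟨x, hx⟩ : P) ∈ Subgroup.normalizer (U : Set P) := by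
    intro x hx
    refine Subgroup.mem_normalizer_fintype fun u hu => ?_
    obtain ⟨⟨v, hv⟩, hvu⟩ := (a : MulAut U).surjective ⟨u, hu⟩
    have h1 := hψa v hv
    rw [hvu] at h1
    have hc := (Subgroup.mem_normalizer_iff.1 hx v).1 hv
    have h2 := hψa _ hc
    rw [show (⟨x * v * x⁻¹, Subgroup.le_normalizer hc⟩ : Subgroup.normalizer (U : Set P)) =
      ⟨x, hx⟩ * ⟨v, Subgroup.le_normalizer hv⟩ * ⟨x, hx⟩⁻¹ from rfl, map_mul, map_mul, map_inv] at h2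
    simp only [Subgroup.coe_mul, Subgroup.coe_inv, h1] at h2
    change _ * u * _ ∈ U
    rw [h2]
    exact SetLike.coe_mem _
  obtain ⟨b, hb, hbψ⟩ := exists_isIso_restrict_of_card_le hψ le_rfl hψN le_rfl
  -- As a ^ p ^ k = 1 and m ≡ 1 modulo p ^ k, the power b ^ m still restricts to a.
  obtain ⟨m, hm, hbm⟩ :=
    exists_modEq_one_pow_eq_one (p := p) (⟨b, hb⟩ : F.aut (Subgroup.normalizer (U : Set P))) k
  obtain ⟨N', e, he, hN'⟩ := F.exists_isFullyNormalized (Subgroup.normalizer (U : Set P))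
  have hlt := card_lt_card_normalizer hP htop
  have hle := Subgroup.card_le_card_group N'
  have hN'' := ih _ (by rw [he.card_eq] at hlt; omega) hN' rfl
  refine hU.mem_conjAut_of_extension (b := ⟨b, hb⟩ ^ m) (fun u => ?_) hbm he hN''
  have ham : a = a ^ m := by
    conv_lhs => rw [← pow_one a]
    exact pow_eq_pow_of_modEq hm.symm hk
  rw [ham]
  exact aut_pow_apply Subgroup.le_normalizer (fun u => (hbψ _).trans (hψa u u.2)) m u

end

/-! ### Lifting isomorphisms modulo Q. -/

section

variable {P : Type*} [Group P] {F : FusionSystem P} {Q : Subgroup P}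

/-- Strong closure gives Qφ ≤ Q; injectivity and finiteness give equality. -/
theorem IsStronglyClosed.exists_apply_eq [Finite P] (hQ : F.IsStronglyClosed Q)
    {R S : Subgroup P} {φ : R →* S} (hφ : φ ∈ F.Hom R S) (hR : Q ≤ R) {q : P} (hq : q ∈ Q) :
    ∃ r, ∃ hr : r ∈ Q, (φ ⟨r, hR hr⟩ : P) = q := by
  obtain ⟨e, -, he⟩ :=
    exists_isIso_restrict_of_card_le hφ hR (fun u hu => (hQ.mem_iff hφ _).2 hu) le_rfl
  obtain ⟨r, hr⟩ := e.surjective ⟨q, hq⟩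
  exact ⟨r, r.2, by rw [← he, hr]⟩

variable [Q.Normal]

theorem IsStronglyClosed.mk_eq (hQ : F.IsStronglyClosed Q) {R S : Subgroup P} {φ : R →* S}
    (hφ : φ ∈ F.Hom R S) {r r' : R} (h : QuotientGroup.mk' Q r = QuotientGroup.mk' Q r') :
    QuotientGroup.mk' Q (φ r) = QuotientGroup.mk' Q (φ r') := by
  have h1 : ((r⁻¹ * r' : R) : P) ∈ Q := QuotientGroup.eq.1 h
  have := (hQ.mem_iff hφ _).2 h1
  rw [map_mul, map_inv] at this
  exact QuotientGroup.eq.2 this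

/-- The isomorphism `e : U → V` agrees modulo `Q` with an isomorphism `UQ → VQ` in `F`. -/
def Liftable (F : FusionSystem P) (Q : Subgroup P) [Q.Normal] {U V : Subgroup P} (e : U ≃* V) :
    Prop :=
  ∃ ψ : (U ⊔ Q : Subgroup P) ≃* (V ⊔ Q : Subgroup P), F.IsIso ψ ∧
    ∀ u : U, QuotientGroup.mk' Q (ψ ⟨u, Subgroup.mem_sup_left u.2⟩) = QuotientGroup.mk' Q (e u)

theorem Liftable.trans (hQ : F.IsStronglyClosed Q) {U V W : Subgroup P} {e : U ≃* V}
    {f : V ≃* W} (he : F.Liftable Q e) (hf : F.Liftable Q f) : F.Liftable Q (e.trans f) := by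
  obtain ⟨ψ, hψ, h⟩ := he
  obtain ⟨χ, hχ, h'⟩ := hf
  refine ⟨ψ.trans χ, hψ.trans hχ, fun u => ?_⟩
  rw [MulEquiv.trans_apply, MulEquiv.trans_apply, ← h']
  exact hQ.mk_eq hχ (h u)

theorem Liftable.symm (hQ : F.IsStronglyClosed Q) {U V : Subgroup P} {e : U ≃* V}
    (he : F.Liftable Q e) : F.Liftable Q e.symm := by
  obtain ⟨ψ, hψ, h⟩ := he
  refine ⟨ψ.symm, hψ.symm, fun v => ?_⟩
  have h1 := h (e.symm v)
  rw [MulEquiv.apply_symm_apply] at h1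
  have h2 := hQ.mk_eq hψ.symm (r' := ⟨v, Subgroup.mem_sup_left v.2⟩) h1
  change QuotientGroup.mk' Q (ψ.symm (ψ _)) = _ at h2
  rw [MulEquiv.symm_apply_apply] at h2
  exact h2.symm

/-- Agreement with e modulo Q forces ψ to carry UQ into VQ. It is onto because ψ maps Q onto Q,
which absorbs the discrepancy between ψ and e. -/
theorem liftable_of_hom [Finite P] (hQ : F.IsStronglyClosed Q) {U V W X : Subgroup P}
    {e : U ≃* V} {ψ : W →* X} (hψ : ψ ∈ F.Hom W X) (hU : U ⊔ Q ≤ W)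
    (h : ∀ u (hu : u ∈ U), QuotientGroup.mk' Q (ψ ⟨u, hU (Subgroup.mem_sup_left hu)⟩) =
      QuotientGroup.mk' Q (e ⟨u, hu⟩)) : F.Liftable Q e := by
  have hUW : U ≤ W := le_sup_left.trans hU
  have hQW : Q ≤ W := le_sup_right.trans hU
  obtain ⟨χ, hχ, hχψ⟩ := exists_isIso_restrict (V := V ⊔ Q) hψ hU (fun w hw => by
    obtain ⟨u, hu, q, hq, rfl⟩ := Subgroup.mem_sup_of_normal_right.1 hw
    have h1 : ((e ⟨u, hu⟩ : V) : P)⁻¹ * ψ ⟨u, hUW hu⟩ ∈ Q := QuotientGroup.eq.1 (h u hu).symm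
    have h2 : (ψ ⟨q, hQW hq⟩ : P) ∈ Q := (hQ.mem_iff hψ _).2 hq
    have h3 : ψ ⟨u * q, hU hw⟩ = ψ ⟨u, hUW hu⟩ * ψ ⟨q, hQW hq⟩ := by rw [← map_mul]; rfl
    rw [h3]
    have := mul_mem (mul_mem (Subgroup.mem_sup_left (T := Q) (e ⟨u, hu⟩).2)
      (Subgroup.mem_sup_right (S := V) h1)) (Subgroup.mem_sup_right (S := V) h2)
    simpa using this) fun v' hv' => by
    obtain ⟨v, hv, q, hq, rfl⟩ := Subgroup.mem_sup_of_normal_right.1 hv'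
    obtain ⟨⟨u, hu⟩, hue⟩ := e.surjective ⟨v, hv⟩
    have h1 : (ψ ⟨u, hUW hu⟩ : P)⁻¹ * (e ⟨u, hu⟩ : V) ∈ Q := QuotientGroup.eq.1 (h u hu)
    rw [hue] at h1
    obtain ⟨r, hr, e'⟩ := hQ.exists_apply_eq hψ hQW (mul_mem h1 hq)
    refine ⟨u * r, mul_mem (Subgroup.mem_sup_left hu) (Subgroup.mem_sup_right hr), ?_⟩
    have h3 : ψ ⟨u * r, mul_mem (hUW hu) (hQW hr)⟩ = ψ ⟨u, hUW hu⟩ * ψ ⟨r, hQW hr⟩ := by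
      rw [← map_mul]; rfl
    rw [h3, Subgroup.coe_mul, e']
    simp [mul_assoc]
  exact ⟨χ, hχ, fun u => by rw [hχψ]; exact h u u.2⟩

theorem liftable_of_le [Finite P] (hQ : F.IsStronglyClosed Q) {U V : Subgroup P} {e : U ≃* V}
    (he : F.IsIso e) (hU : Q ≤ U) : F.Liftable Q e :=
  liftable_of_hom hQ he (sup_le le_rfl hU) fun _ _ => rfl

/-- An isomorphism agreeing modulo `Q` with the restriction of a liftable one is liftable. -/
theorem liftable_of_restrict [Finite P] (hQ : F.IsStronglyClosed Q) {M X : Subgroup P}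
    {φ : M →* X} (hφ : φ ∈ F.Hom M X)
    (hM : ∀ {V : Subgroup P} (f : M ≃* V), F.IsIso f → F.Liftable Q f)
    {U V : Subgroup P} {e : U ≃* V} (hU : U ≤ M)
    (h : ∀ u (hu : u ∈ U), QuotientGroup.mk' Q (φ ⟨u, hU hu⟩) =
      QuotientGroup.mk' Q (e ⟨u, hu⟩)) : F.Liftable Q e := by
  obtain ⟨f, hf, hfφ⟩ := exists_isIso_image hφ
  obtain ⟨ψ, hψ, hψf⟩ := hM f hf
  refine liftable_of_hom hQ hψ (sup_le_sup_right hU Q) fun u hu => ?_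
  rw [← h, ← hfφ]
  exact hψf ⟨u, hU hu⟩

/-- The automorphisms in `Aut_F(U)` that are trivial modulo `Q`. -/
def autMod (F : FusionSystem P) (Q : Subgroup P) [Q.Normal] (U : Subgroup P) :
    Subgroup (F.aut U) where
  carrier := {a | ∀ u : U,
    QuotientGroup.mk' Q ((a : MulAut U) u) = QuotientGroup.mk' Q (u : P)}
  one_mem' _ := rfl
  mul_mem' {a b} ha hb u := (ha _).trans (hb u)
  inv_mem' {a} ha u := by
    have := ha ((a⁻¹ : MulAut U) u)
    rw [MulAut.apply_inv_self] at this
    exact this.symm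

/-- By strong closure every F-automorphism respects congruence modulo Q, so this is the kernel of
the action on UQ/Q. -/
theorem IsStronglyClosed.autMod_normal (hQ : F.IsStronglyClosed Q) (U : Subgroup P) :
    (F.autMod Q U).Normal := by
  refine ⟨fun k hk g u => ?_⟩
  have h1 := hQ.mk_eq (φ := MulEquiv.toMonoidHom (g : MulAut U)) g.2
    (hk ((g⁻¹ : MulAut U) u))
  change _ = QuotientGroup.mk' Q ((g : MulAut U) ((g⁻¹ : MulAut U) u)) at h1
  rw [MulAut.apply_inv_self] at h1
  exact h1

/-- An automorphism of a fully normalized subgroup `U` not containing `Q` agrees modulo `Q` with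
an automorphism that extends to a strictly larger subgroup. -/
theorem IsFullyNormalized.exists_extension_mod {p : ℕ} [Fact p.Prime] [Finite P]
    (hP : IsPGroup p P) (hF : F.IsSaturated p) (hQ : F.IsStronglyClosed Q) {U : Subgroup P}
    (hU : F.IsFullyNormalized U) (hQU : ¬ Q ≤ U) {a : MulAut U} (ha : a ∈ F.aut U) :
    ∃ (M : Subgroup P) (hM : U < M), ∃ φ ∈ F.Hom M ⊤, ∀ u (hu : u ∈ U),
      QuotientGroup.mk' Q (φ ⟨u, hM.le hu⟩) = QuotientGroup.mk' Q (a ⟨u, hu⟩) := by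
  have hK := hQ.autMod_normal (F := F) U
  obtain ⟨S, hS⟩ := hU.isFullyAutomized hP hF
  let N := Subgroup.normalizer (U : Set P)
  let c : N →* F.aut U := U.normalizerMonoidHom.codRestrict _ (normalizerMonoidHom_mem_aut U)
  -- T consists of the automorphisms induced by N_Q(U); they are trivial modulo Q.
  let T : Subgroup (F.aut U) := (Q.subgroupOf N).map c
  have hT : IsPGroup p T := ((hP.to_subgroup N).to_subgroup _).map c
  have hTK : T ≤ F.autMod Q U := by
    rintro _ ⟨x, hx, rfl⟩ u
    have hx' : QuotientGroup.mk' Q (x : P) = 1 := (QuotientGroup.eq_one_iff _).2 hx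
    change QuotientGroup.mk' Q ((x : P) * u * (x : P)⁻¹) = _
    rw [map_mul, map_mul, map_inv, hx']
    simp
  let g : F.aut U := ⟨a, ha⟩
  have hT' : IsPGroup p (T.map (MulAut.conj g).toMonoidHom) := hT.map _
  -- The conjugate of T by a stays in the normal subgroup K, so k can be taken in K and k * a agrees
  -- with a modulo Q.
  obtain ⟨k, hk, h⟩ := S.exists_conj_mem_of_le_normal hT' (K := F.autMod Q U) (by
    rintro _ ⟨t, ht, rfl⟩
    exact hK.conj_mem t (hTK ht) g)
  have hχ : F.IsIso (U := U) (V := U) ((k * g : F.aut U) : MulAut U) := (k * g).2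
  let M : Subgroup P := U ⊔ (Q ⊓ N)
  -- Normalizers grow in UQ > U; the Q-part of a new element normalizing U lies in N_Q(U) but not in
  -- U.
  have hM : U < M := by
    have hlt : U < U ⊔ Q := lt_of_le_of_ne le_sup_left fun e => hQU (e ▸ le_sup_right)
    obtain ⟨x, hx, hxU, hxN⟩ := exists_notMem_mem_normalizer hP hlt
    obtain ⟨u, hu, q, hq, rfl⟩ := Subgroup.mem_sup_of_normal_right.1 hx
    have hqN : q ∈ N := by
      have := mul_mem (inv_mem (Subgroup.le_normalizer hu)) hxN
      simpa using this
    refine lt_of_le_of_ne le_sup_left fun e => hxU (mul_mem hu ?_)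
    rw [e]
    exact Subgroup.mem_sup_right ⟨hq, hqN⟩
  have hE : ∀ x ∈ M, x ∈ N ∧ ∃ y ∈ N, ∀ v v' : U, (v' : P) = x * v * x⁻¹ →
      (((k * g : F.aut U) : MulAut U) v' : P) =
        y * ((k * g : F.aut U) : MulAut U) v * y⁻¹ := by
    intro x hx
    have hMN : M ≤ N := sup_le Subgroup.le_normalizer inf_le_right
    have hc : ∀ x : N, (x : P) ∈ M → k * g * c x * (k * g)⁻¹ ∈ F.conjAut U := by
      intro x hx
      -- The x that k * g conjugates into Aut_P(U) form a subgroup, so generators of M suffice: for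
      -- U inner automorphisms go to inner ones, and for N_Q(U) this is the choice of k.
      let L : Subgroup N := ((F.conjAut U).comap (MulAut.conj (k * g)).toMonoidHom).comap c
      have hUL : U ≤ L.map N.subtype := by
        intro u hu
        refine ⟨⟨u, Subgroup.le_normalizer hu⟩, mem_conjAut.2
          ⟨((k * g : F.aut U) : MulAut U) ⟨u, hu⟩, Subgroup.le_normalizer (SetLike.coe_mem _),
            fun v => ?_⟩, rfl⟩
        change ((((k * g : F.aut U) : MulAut U)
          (⟨u, hu⟩ * (((k * g : F.aut U) : MulAut U)⁻¹ v) * ⟨u, hu⟩⁻¹) : U) : P) = _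
        rw [map_mul, map_mul, map_inv, MulAut.apply_inv_self]
        rfl
      have hQL : Q ⊓ N ≤ L.map N.subtype := by
        rintro q ⟨hq, hqN⟩
        refine ⟨⟨q, hqN⟩, ?_, rfl⟩
        have h1 := h _ ⟨c ⟨q, hqN⟩, ⟨_, hq, rfl⟩, rfl⟩
        change _ ∈ (S : Subgroup (F.aut U)) at h1
        rw [hS] at h1
        change k * g * c ⟨q, hqN⟩ * (k * g)⁻¹ ∈ F.conjAut U
        simpa [mul_assoc] using h1
      obtain ⟨y, hy, hyx⟩ := (sup_le hUL hQL : M ≤ _) hx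
      obtain rfl : y = x := Subtype.ext hyx
      exact hy
    obtain ⟨y, hy, hy'⟩ := mem_conjAut.1 (hc ⟨x, hMN hx⟩ hx)
    refine ⟨hMN hx, y, hy, fun v v' hv => ?_⟩
    rw [← hy']
    have : v' = (c ⟨x, hMN hx⟩ : MulAut U) v := Subtype.ext hv
    rw [this]
    simp [MulAut.mul_apply]
  obtain ⟨φ, hφ, hφχ⟩ := hF.exists_extension hχ hU hM.le hE
  refine ⟨M, hM, φ, hφ, fun u hu => ?_⟩
  rw [hφχ]
  exact hk (a ⟨u, hu⟩)

/-- Downward induction on |U|, factoring e through a fully normalized conjugate W and correcting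
each factor so that it extends to a larger subgroup. -/
theorem IsIso.liftable {p : ℕ} [Fact p.Prime] [Finite P] (hP : IsPGroup p P)
    (hF : F.IsSaturated p) (hQ : F.IsStronglyClosed Q) {U V : Subgroup P} {e : U ≃* V}
    (he : F.IsIso e) : F.Liftable Q e := by
  induction hn : Nat.card P - Nat.card U using Nat.strong_induction_on generalizing U V with
  | _ n ih =>
  subst hn
  have key : ∀ {M : Subgroup P}, Nat.card U < Nat.card M →
      ∀ {V : Subgroup P} (f : M ≃* V), F.IsIso f → F.Liftable Q f := by
    intro M hM V f hf
    have := Subgroup.card_le_card_group M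
    exact ih _ (by omega) hf rfl
  by_cases hU : U = ⊤
  · exact liftable_of_le hQ he (hU ▸ le_top)
  obtain ⟨W, f, hf, hW⟩ := F.exists_isFullyNormalized U
  have hW' := hW.isFullyAutomized hP hF
  -- Applied to X = U and X = V: the corrected isomorphism extends to N_P(X) > X, where the
  -- induction hypothesis applies.
  have aux : ∀ {X : Subgroup P} {f : X ≃* W}, F.IsIso f → Nat.card X = Nat.card U →
      ∃ f' : X ≃* W, F.IsIso f' ∧ F.Liftable Q f' := by
    intro X f hf hc
    have hX : X ≠ ⊤ := by
      rintro rfl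
      exact hU (Subgroup.eq_top_of_card_eq _ (by rw [← hc, Subgroup.card_top]))
    obtain ⟨f', hf', ψ, hψ, h⟩ := hf.exists_extension_normalizer hP hF hW hW'
    exact ⟨f', hf', liftable_of_restrict hQ hψ (key (hc ▸ card_lt_card_normalizer hP hX))
      Subgroup.le_normalizer fun u hu => by rw [h]⟩
  obtain ⟨α, hα, hα'⟩ := aux hf rfl
  obtain ⟨β, hβ, hβ'⟩ := aux (he.symm.trans hf) he.card_eq.symm
  -- The corrections change α and β; a is what remains of e after them.
  let a : MulAut W := (α.symm.trans e).trans β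
  have ha : a ∈ F.aut W := (hα.symm.trans he).trans hβ
  have ha' : F.Liftable Q (V := W) a := by
    by_cases hQW : Q ≤ W
    · exact liftable_of_le hQ ha hQW
    obtain ⟨M, hM, φ, hφ, h⟩ := hW.exists_extension_mod hP hF hQ hQW ha
    refine liftable_of_restrict hQ hφ (key ?_) hM.le h
    rw [hf.card_eq]
    exact Set.ncard_lt_ncard (SetLike.coe_ssubset_coe.2 hM) (Set.toFinite _)
  have := (hα'.trans hQ ha').trans hQ (hβ'.symm hQ)
  convert this
  ext u
  simp [a]

end

/-! ### Comparison of the two quotient systems, and the natural morphism. -/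

section

variable {P : Type*} [Group P] {F : FusionSystem P} {Q : Subgroup P} [Q.Normal]

theorem factorSystem_toPrefusionSystem_eq {p : ℕ} [Fact p.Prime] [Finite P]
    (hP : IsPGroup p P) (hF : F.IsSaturated p) (hQ : F.IsStronglyClosed Q) :
    (F.factorSystem Q).toPrefusionSystem = F.barSystem Q hQ := by
  refine PrefusionSystem.ext (funext fun A => funext fun B => Set.ext fun θ => ⟨?_, ?_⟩)
  · rintro ⟨R, S, φ, -, -, hφ, -, h⟩
    exact ⟨R, S, φ, hφ, h⟩
  rintro ⟨R, S, φ, hφ, h1, h2, h3⟩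
  obtain ⟨e, he, heφ⟩ := exists_isIso_image hφ
  -- The lift ψ, on RQ, replaces φ: it induces the same map on RQ/Q.
  obtain ⟨ψ, hψ, h⟩ := he.liftable hP hF hQ
  have hle : imageSubgroup φ ⊔ Q ≤ S ⊔ Q := by
    refine sup_le_sup_right ?_ Q
    rintro _ ⟨s, -, rfl⟩
    exact s.2
  have hmap : ∀ R : Subgroup P,
      (R ⊔ Q).map (QuotientGroup.mk' Q) = R.map (QuotientGroup.mk' Q) := by
    intro R
    rw [Subgroup.map_sup, QuotientGroup.map_mk'_self, sup_bot_eq]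
  have hψ' := F.comp_mem hψ (F.inclusion_mem hle)
  refine ⟨R ⊔ Q, S ⊔ Q, _, le_sup_right, le_sup_right, hψ', ?_, (hmap R).trans h1,
    (hmap S).trans h2, ?_⟩
  · refine map_eq_of (fun r hr => (hQ.mem_iff hψ' r).2 hr) fun q hq => ?_
    obtain ⟨r, hr, e⟩ := hQ.exists_apply_eq hψ' le_sup_right hq
    exact ⟨_, hr, e⟩
  · rintro ⟨w, hw⟩ a ha
    obtain ⟨r, hr, q, hq, rfl⟩ := Subgroup.mem_sup_of_normal_right.1 hw
    have hrq : QuotientGroup.mk' Q (r * q) = QuotientGroup.mk' Q r := by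
      rw [map_mul, show QuotientGroup.mk' Q q = 1 from (QuotientGroup.eq_one_iff q).2 hq, mul_one]
    rw [h3 ⟨r, hr⟩ a (ha.trans hrq), ← heφ, ← h]
    exact hQ.mk_eq hψ (r' := ⟨r * q, hw⟩) hrq.symm

/-- Defined through chosen coset representatives; by strong closure the choice does not matter,
which also gives multiplicativity. -/
theorem exists_isInducedBy (hQ : F.IsStronglyClosed Q) {R S : Subgroup P} {φ : R →* S}
    (hφ : φ ∈ F.Hom R S) :
    ∃ θ : R.map (QuotientGroup.mk' Q) →* S.map (QuotientGroup.mk' Q), IsInducedBy θ φ := by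
  have hrep : ∀ a : R.map (QuotientGroup.mk' Q), ∃ r : R, QuotientGroup.mk' Q r = (a : P ⧸ Q) := by
    rintro ⟨_, r, hr, rfl⟩
    exact ⟨⟨r, hr⟩, rfl⟩
  choose s hs using hrep
  let f : R.map (QuotientGroup.mk' Q) → S.map (QuotientGroup.mk' Q) := fun a =>
    ⟨QuotientGroup.mk' Q (φ (s a)), φ (s a), (φ (s a)).2, rfl⟩
  refine ⟨MonoidHom.mk' f fun a b => Subtype.ext ?_, rfl, rfl, fun r a ha => ?_⟩
  · change QuotientGroup.mk' Q _ = QuotientGroup.mk' Q _ * QuotientGroup.mk' Q _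
    rw [hQ.mk_eq hφ (r := s (a * b)) (r' := s a * s b)
      (by rw [hs, Subgroup.coe_mul, Subgroup.coe_mul, map_mul, hs, hs]), map_mul φ, Subgroup.coe_mul,
      map_mul]
  · exact hQ.mk_eq hφ ((hs a).trans ha)

theorem isInducedBy_unique {A B : Subgroup (P ⧸ Q)} {θ θ' : A →* B} {R S : Subgroup P}
    {φ : R →* S} (h : IsInducedBy θ φ) (h' : IsInducedBy θ' φ) : θ = θ' := by
  ext a
  obtain ⟨r, hr⟩ := h.exists_rep a
  rw [h.2.2 r a hr, h'.2.2 r a hr]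

/-- The natural morphism `F → F/Q`. -/
theorem exists_morphism_factorSystem {p : ℕ} [Fact p.Prime] [Finite P]
    (hP : IsPGroup p P) (hF : F.IsSaturated p) (hQ : F.IsStronglyClosed Q) :
    ∃ Φ : FusionSystem.Morphism F (F.factorSystem Q),
      Φ.toHom = QuotientGroup.mk' Q ∧
      ∀ (R S : Subgroup P) (α : F.Hom R S),
        IsInducedBy (Φ.map R S α : R.map Φ.toHom →* S.map Φ.toHom) (α : R →* S) := by
  choose f hf using fun (R S : Subgroup P) (α : F.Hom R S) =>
    exists_isInducedBy hQ α.2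
  have hmem : ∀ (R S : Subgroup P) (α : F.Hom R S), f R S α ∈ (F.factorSystem Q).Hom _ _ := by
    intro R S α
    rw [factorSystem_toPrefusionSystem_eq hP hF hQ]
    exact ⟨R, S, α, α.2, hf R S α⟩
  refine ⟨⟨QuotientGroup.mk' Q, fun R S α => ⟨f R S α, hmem R S α⟩, fun R => ?_,
    fun R S T α β => ?_⟩, rfl, hf⟩
  · exact isInducedBy_unique (hf R R _) ⟨rfl, rfl, fun _ _ h => h⟩
  · exact isInducedBy_unique (hf R T _) ⟨rfl, rfl, fun r a h =>
      (hf S T β).2.2 _ _ ((hf R S α).2.2 r a h)⟩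

end

end FusionSystem

theorem mainTheorem7 {p : ℕ} [Fact p.Prime] {P : Type*} [Group P] [Finite P]
    (hP : IsPGroup p P) (F : FusionSystem P) (hF : F.IsSaturated p)
    (Q : Subgroup P) (hQ : F.IsStronglyClosed Q) :
    haveI : Q.Normal := hQ.normal
    (F.factorSystem Q).toPrefusionSystem = F.barSystem Q hQ ∧
    ∃ Φ : FusionSystem.Morphism F (F.factorSystem Q),
      Φ.toHom = QuotientGroup.mk' Q ∧
      ∀ (R S : Subgroup P) (α : F.Hom R S),
        IsInducedBy (Φ.map R S α : R.map Φ.toHom →* S.map Φ.toHom) (α : R →* S) := by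
  have : Q.Normal := hQ.normal
  exact ⟨FusionSystem.factorSystem_toPrefusionSystem_eq hP hF hQ,
    FusionSystem.exists_morphism_factorSystem hP hF hQ⟩
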